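/- Let $k$ and $m$ be positive integers with $k<m<2k$. For integers $n,r,s\ge 0$, let $d_k(m,n,r,s)$ denote the number of tilings of the $m\times n\times k$ cuboid, placed with a corner at the origin and with its sides of length $n$, $m$ and $k$ along the $x$-, $y$- and $z$-axes respectively, by axis-parallel $k\times k\times 1$ bricks (each brick being a union of unit cells of the integer grid, in any of the three orientations), which contain precisely $r$ bricks parallel to the $yz$-plane and precisely $s$ bricks parallel to the $xy$-plane. (A brick is parallel to the plane that its $k\times k$ faces are parallel to; for $n=0$ the empty tiling is the only one.) Then, as formal power series in $x,y,z$, $$\sum_{n,r,s\geq 0}d_k(m,n,r,s)\,x^ny^rz^s=\frac{(1-x^k-x^kz^k)^{k-1}}{\left(1-x^k-(m-k+1)x^kz^k\right)(1-x^k-x^kz^k)^{k-1}-(m-k+1)x^ky^k},$$ where the denominator is invertible, having constant term $1$. -/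

import Mathlib

namespace BrickTiling

/-- A unit cell of the octant, named by its corner `(x, y, z)` closest to the origin: the cell is
the cube `[x, x+1] × [y, y+1] × [z, z+1]`. -/
abbrev Cell : Type := ℕ × ℕ × ℕ

/-- The cells of the box with corner `p` closest to the origin and side lengths `a`, `b`, `c` along
the `x`-, `y`- and `z`-axes respectively. -/
def box (p : Cell) (a b c : ℕ) : Finset Cell :=
  Finset.Ico p.1 (p.1 + a) ×ˢ Finset.Ico p.2.1 (p.2.1 + b) ×ˢ Finset.Ico p.2.2 (p.2.2 + c)

/-- The `m × n × k` cuboid with a corner at the origin: its sides have length `n` along the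
`x`-axis, `m` along the `y`-axis and `k` along the `z`-axis. -/
def cuboid (k m n : ℕ) : Finset Cell := box (0, 0, 0) n m k

/-- A `k × k × 1` brick parallel to the `yz`-plane. -/
def IsBrickYZ (k : ℕ) (B : Finset Cell) : Prop := ∃ p : Cell, B = box p 1 k k

/-- A `k × k × 1` brick parallel to the `xz`-plane. -/
def IsBrickXZ (k : ℕ) (B : Finset Cell) : Prop := ∃ p : Cell, B = box p k 1 k

/-- A `k × k × 1` brick parallel to the `xy`-plane. -/
def IsBrickXY (k : ℕ) (B : Finset Cell) : Prop := ∃ p : Cell, B = box p k k 1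

/-- A `k × k × 1` brick, in any of its three orientations. -/
def IsBrick (k : ℕ) (B : Finset Cell) : Prop :=
  IsBrickYZ k B ∨ IsBrickXZ k B ∨ IsBrickXY k B

/-- `T` is a tiling of the `m × n × k` cuboid by `k × k × 1` bricks. -/
structure IsTiling (k m n : ℕ) (T : Finset (Finset Cell)) : Prop where
  isBrick : ∀ B ∈ T, IsBrick k B
  pairwiseDisjoint : ∀ B ∈ T, ∀ C ∈ T, B ≠ C → Disjoint B C
  covers : T.biUnion id = cuboid k m n

open Classical in
/-- The tilings of the `m × n × k` cuboid by `k × k × 1` bricks with precisely `r` bricks parallel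
to the `yz`-plane and `s` bricks parallel to the `xy`-plane. -/
def tilings (k m n r s : ℕ) : Set (Finset (Finset Cell)) :=
  {T | IsTiling k m n T ∧ (T.filter (IsBrickYZ k)).card = r ∧ (T.filter (IsBrickXY k)).card = s}

/-- There are only finitely many such tilings, so `Set.ncard` really counts them. -/
theorem tilings_finite (k m n r s : ℕ) : (tilings k m n r s).Finite := by
  refine Set.Finite.subset (Finset.finite_toSet (cuboid k m n).powerset.powerset) ?_
  intro T hT
  simp only [Finset.mem_coe, Finset.mem_powerset]
  intro B hB
  rw [Finset.mem_powerset, ← hT.1.covers]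
  exact Finset.subset_biUnion_of_mem id hB

/-- `d k m n r s` is the number of tilings of the `m × n × k` cuboid by `k × k × 1` bricks with
precisely `r` bricks parallel to the `yz`-plane and `s` bricks parallel to the `xy`-plane. -/
noncomputable def d (k m n r s : ℕ) : ℕ := (tilings k m n r s).ncard

/-- The generating function `∑ d k m n r s * x ^ n * y ^ r * z ^ s`, the sum being over all
`n, r, s ≥ 0`, as a formal power series in `x = X 0`, `y = X 1`, `z = X 2`. -/
noncomputable def genFun (k m : ℕ) : MvPowerSeries (Fin 3) ℚ :=
  fun e => (d k m (e 0) (e 1) (e 2) : ℚ)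

end BrickTiling

namespace BrickTiling

/-! Since `m < 2 * k`, a brick parallel to the `yz`- or `xy`-plane spans `k` of the `m` rows and so
meets the row `y = k - 1`. The brick covering the last cell of that row, at height 0, therefore
decides how a tiling ends (`tiling_end`). If it is parallel to the `xz`-plane, so is the last brick
of every row. If it is parallel to the `xy`-plane, it belongs to a full stack of `k` such bricks,
and every other row ends with a brick parallel to the `xz`-plane. If it is parallel to the
`yz`-plane and the end is flat, every row it misses ends with a brick parallel to the `xz`-plane,
which leaves `k` consecutive rows longer than the others by `k - 1`.

This leads to the regions whose rows `[j, j + k)` exceed the others by `δ < k`. At a jagged end the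
position of a crosswise brick is forced to be `j`. With `F` the generating function sought, `R_δ`
that of these regions (`x` marking the longer length) and `Q = 1 - x^k - x^k z^k`, counting by ends
gives `Q R_(δ+1) = x y R_δ` with `R_0 = F`, so `Q^(k-1) R_(k-1) = (x y)^(k-1) F` for each of the `m
- k + 1` values of `j` (`pow_mul_regionSeries`). A flat end gives `F = 1 + (m-k+1) x y R_(k-1) + x^k
F + (m-k+1) x^k z^k F` (`genFun_eq`). Multiplying by `Q^(k-1)` eliminates `R_(k-1)`. -/

theorem mem_box {p c : Cell} {a b h : ℕ} :
    c ∈ box p a b h ↔ (p.1 ≤ c.1 ∧ c.1 < p.1 + a) ∧ (p.2.1 ≤ c.2.1 ∧ c.2.1 < p.2.1 + b) ∧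
      (p.2.2 ≤ c.2.2 ∧ c.2.2 < p.2.2 + h) := by
  simp [box, Finset.mem_product]

/-- The two extreme corner cells determine a nonempty box. For `2 ≤ k` this separates the three
orientations of a brick. -/
theorem box_inj {x y z x' y' z' a b c a' b' c' : ℕ} (ha : 0 < a) (hb : 0 < b) (hc : 0 < c)
    (ha' : 0 < a') (hb' : 0 < b') (hc' : 0 < c')
    (h : box (x, y, z) a b c = box (x', y', z') a' b' c') :
    (x = x' ∧ a = a') ∧ (y = y' ∧ b = b') ∧ (z = z' ∧ c = c') := by
  have h₁ := (Finset.ext_iff.1 h (x, y, z)).1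
  have h₂ := (Finset.ext_iff.1 h (x', y', z')).2
  have h₃ := (Finset.ext_iff.1 h (x + a - 1, y + b - 1, z + c - 1)).1
  have h₄ := (Finset.ext_iff.1 h (x' + a' - 1, y' + b' - 1, z' + c' - 1)).2
  simp only [mem_box] at h₁ h₂ h₃ h₄
  omega

/-! ### Tilings of arbitrary regions, counted by the patch they contain -/

/-- `T` is a tiling of the region `R` by `k × k × 1` bricks. -/
structure IsTilingOf (k : ℕ) (R : Finset Cell) (T : Finset (Finset Cell)) : Prop where
  isBrick : ∀ B ∈ T, IsBrick k B
  pairwiseDisjoint : ∀ B ∈ T, ∀ C ∈ T, B ≠ C → Disjoint B C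
  covers : T.biUnion id = R

theorem isTiling_iff {k m n : ℕ} {T : Finset (Finset Cell)} :
    IsTiling k m n T ↔ IsTilingOf k (cuboid k m n) T :=
  ⟨fun h => ⟨h.1, h.2, h.3⟩, fun h => ⟨h.1, h.2, h.3⟩⟩

theorem IsBrick.nonempty {k : ℕ} (hk : 0 < k) {B : Finset Cell} (h : IsBrick k B) :
    B.Nonempty := by
  rcases h with ⟨p, rfl⟩ | ⟨p, rfl⟩ | ⟨p, rfl⟩ <;> exact ⟨p, by simp [mem_box, hk]⟩

namespace IsTilingOf

variable {k : ℕ} {R : Finset Cell} {T : Finset (Finset Cell)}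

theorem exists_mem (h : IsTilingOf k R T) {c : Cell} (hc : c ∈ R) : ∃ B ∈ T, c ∈ B := by
  simpa [← h.covers] using hc

theorem subset (h : IsTilingOf k R T) {B : Finset Cell} (hB : B ∈ T) : B ⊆ R := by
  rw [← h.covers]
  exact Finset.subset_biUnion_of_mem id hB

theorem eq_of_mem (h : IsTilingOf k R T) {B C : Finset Cell} (hB : B ∈ T) (hC : C ∈ T) {c : Cell}
    (hcB : c ∈ B) (hcC : c ∈ C) : B = C := by
  by_contra hne
  exact Finset.disjoint_left.1 (h.pairwiseDisjoint B hB C hC hne) hcB hcC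

theorem sdiff (h : IsTilingOf k R T) {P : Finset (Finset Cell)} (hP : P ⊆ T) :
    IsTilingOf k (R \ P.biUnion id) (T \ P) where
  isBrick B hB := h.isBrick B (Finset.mem_sdiff.1 hB).1
  pairwiseDisjoint B hB C hC := h.pairwiseDisjoint B (Finset.mem_sdiff.1 hB).1 C
    (Finset.mem_sdiff.1 hC).1
  covers := by
    ext c
    simp only [Finset.mem_biUnion, Finset.mem_sdiff, id, ← h.covers]
    constructor
    · rintro ⟨B, ⟨hB, hBP⟩, hc⟩
      refine ⟨⟨B, hB, hc⟩, ?_⟩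
      rintro ⟨C, hC, hcC⟩
      exact hBP (h.eq_of_mem hB (hP hC) hc hcC ▸ hC)
    · rintro ⟨⟨B, hB, hc⟩, hn⟩
      exact ⟨B, ⟨hB, fun hBP => hn ⟨B, hBP, hc⟩⟩, hc⟩

theorem union {R' : Finset Cell} {T' : Finset (Finset Cell)} (h : IsTilingOf k R T)
    (h' : IsTilingOf k R' T') (hd : Disjoint R R') : IsTilingOf k (R ∪ R') (T ∪ T') where
  isBrick B hB := (Finset.mem_union.1 hB).elim (h.isBrick B) (h'.isBrick B)
  pairwiseDisjoint B hB C hC hne := by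
    rcases Finset.mem_union.1 hB with hB | hB <;> rcases Finset.mem_union.1 hC with hC | hC
    · exact h.pairwiseDisjoint B hB C hC hne
    · exact Finset.disjoint_of_subset_left (h.subset hB)
        (Finset.disjoint_of_subset_right (h'.subset hC) hd)
    · exact (Finset.disjoint_of_subset_left (h.subset hC)
        (Finset.disjoint_of_subset_right (h'.subset hB) hd)).symm
    · exact h'.pairwiseDisjoint B hB C hC hne
  covers := by
    rw [← h.covers, ← h'.covers, Finset.union_biUnion]

theorem disjoint_tiles (hk : 0 < k) {R' : Finset Cell} {T' : Finset (Finset Cell)}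
    (h : IsTilingOf k R T) (h' : IsTilingOf k R' T') (hd : Disjoint R R') : Disjoint T T' := by
  rw [Finset.disjoint_left]
  intro B hB hB'
  obtain ⟨c, hc⟩ := (h.isBrick B hB).nonempty hk
  exact Finset.disjoint_left.1 hd (h.subset hB hc) (h'.subset hB' hc)

end IsTilingOf

open Classical in
/-- The number of bricks of `T` parallel to the `yz`-plane. -/
noncomputable def yzCount (k : ℕ) (T : Finset (Finset Cell)) : ℕ := (T.filter (IsBrickYZ k)).card

open Classical in
/-- The number of bricks of `T` parallel to the `xy`-plane. -/
noncomputable def xyCount (k : ℕ) (T : Finset (Finset Cell)) : ℕ := (T.filter (IsBrickXY k)).card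

theorem yzCount_union {k : ℕ} {S T : Finset (Finset Cell)} (h : Disjoint S T) :
    yzCount k (S ∪ T) = yzCount k S + yzCount k T := by
  classical
  rw [yzCount, Finset.filter_union, Finset.card_union_of_disjoint (Finset.disjoint_filter_filter h)]
  rfl

theorem xyCount_union {k : ℕ} {S T : Finset (Finset Cell)} (h : Disjoint S T) :
    xyCount k (S ∪ T) = xyCount k S + xyCount k T := by
  classical
  rw [xyCount, Finset.filter_union, Finset.card_union_of_disjoint (Finset.disjoint_filter_filter h)]
  rfl

open Classical in
/-- The tilings of the region `R` with `r` bricks parallel to the `yz`-plane and `s` bricks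
parallel to the `xy`-plane. -/
noncomputable def tilingsOf (k : ℕ) (R : Finset Cell) (r s : ℕ) : Finset (Finset (Finset Cell)) :=
  R.powerset.powerset.filter fun T => IsTilingOf k R T ∧ yzCount k T = r ∧ xyCount k T = s

theorem mem_tilingsOf {k r s : ℕ} {R : Finset Cell} {T : Finset (Finset Cell)} :
    T ∈ tilingsOf k R r s ↔ IsTilingOf k R T ∧ yzCount k T = r ∧ xyCount k T = s := by
  simp only [tilingsOf, Finset.mem_filter, Finset.mem_powerset, and_iff_right_iff_imp]
  exact fun h B hB => Finset.mem_powerset.2 (h.1.subset hB)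

theorem d_eq_card (k m n r s : ℕ) : d k m n r s = (tilingsOf k (cuboid k m n) r s).card := by
  rw [d, ← Set.ncard_coe_finset]
  congr 1
  ext T
  simp only [tilings, Set.mem_ofPred_eq, isTiling_iff, Finset.mem_coe, mem_tilingsOf]
  rfl

open Classical in
/-- The tilings in `tilingsOf k R r s` that contain the patch `P`. -/
noncomputable def tilingsWith (k : ℕ) (R : Finset Cell) (r s : ℕ) (P : Finset (Finset Cell)) :
    Finset (Finset (Finset Cell)) :=
  (tilingsOf k R r s).filter (P ⊆ ·)

theorem mem_tilingsWith {k r s : ℕ} {R : Finset Cell} {P T : Finset (Finset Cell)} :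
    T ∈ tilingsWith k R r s P ↔ T ∈ tilingsOf k R r s ∧ P ⊆ T := by
  simp [tilingsWith]

/-- If every tiling of `R` contains exactly one of the patches `P i`, then the tilings of `R` are
counted by the patch they contain. -/
theorem card_tilingsOf_eq_sum {ι : Type*} {k : ℕ} {R : Finset Cell} (I : Finset ι)
    (P : ι → Finset (Finset Cell)) (hex : ∀ T, IsTilingOf k R T → ∃ i ∈ I, P i ⊆ T)
    (huniq : ∀ T, IsTilingOf k R T → ∀ i ∈ I, ∀ j ∈ I, P i ⊆ T → P j ⊆ T → i = j) (r s : ℕ) :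
    (tilingsOf k R r s).card = ∑ i ∈ I, (tilingsWith k R r s (P i)).card := by
  classical
  rw [← Finset.card_biUnion]
  · congr 1
    ext T
    simp only [Finset.mem_biUnion, mem_tilingsWith]
    constructor
    · intro h
      obtain ⟨i, hi, hP⟩ := hex T (mem_tilingsOf.1 h).1
      exact ⟨i, hi, h, hP⟩
    · rintro ⟨_, _, h, _⟩
      exact h
  · intro i hi j hj hne
    rw [Function.onFun, Finset.disjoint_left]
    intro T h₁ h₂
    rw [mem_tilingsWith] at h₁ h₂
    exact hne (huniq T (mem_tilingsOf.1 h₁.1).1 i hi j hj h₁.2 h₂.2)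

/-- Removing a patch `P` is a bijection from the tilings of `R` containing `P` to the tilings of
the rest `R'` of the region. -/
theorem card_tilingsWith {k : ℕ} (hk : 0 < k) {R R' : Finset Cell} {P : Finset (Finset Cell)}
    (hbrick : ∀ B ∈ P, IsBrick k B) (hdisj : ∀ B ∈ P, ∀ C ∈ P, B ≠ C → Disjoint B C)
    (hsub : ∀ B ∈ P, B ⊆ R) (hR' : ∀ c, c ∈ R' ↔ c ∈ R ∧ ∀ B ∈ P, c ∉ B) (r s : ℕ) :
    (tilingsWith k R r s P).card =
      if yzCount k P ≤ r ∧ xyCount k P ≤ s then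
        (tilingsOf k R' (r - yzCount k P) (s - xyCount k P)).card else 0 := by
  have hP : IsTilingOf k (P.biUnion id) P := ⟨hbrick, hdisj, rfl⟩
  have hRR : R' = R \ P.biUnion id := by
    ext c
    simp [hR' c]
  have hPR : P.biUnion id ⊆ R := Finset.biUnion_subset.2 hsub
  have hd : Disjoint (P.biUnion id) R' := hRR ▸ Finset.disjoint_sdiff
  have hu : P.biUnion id ∪ R' = R := by rw [hRR, Finset.union_sdiff_of_subset hPR]
  split_ifs with hc
  · refine Finset.card_bij' (fun T _ => T \ P) (fun T _ => P ∪ T) ?_ ?_ ?_ ?_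
    · intro T hT
      rw [mem_tilingsWith, mem_tilingsOf] at hT
      have hy := yzCount_union (k := k) (Finset.disjoint_sdiff (s := P) (t := T))
      have hx := xyCount_union (k := k) (Finset.disjoint_sdiff (s := P) (t := T))
      rw [Finset.union_sdiff_of_subset hT.2] at hx hy
      rw [mem_tilingsOf, hRR]
      exact ⟨hT.1.1.sdiff hT.2, by omega, by omega⟩
    · intro T hT
      rw [mem_tilingsOf] at hT
      have hdT := hP.disjoint_tiles hk hT.1 hd
      rw [mem_tilingsWith, mem_tilingsOf, yzCount_union hdT, xyCount_union hdT, ← hu]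
      exact ⟨⟨hP.union hT.1 hd, by omega, by omega⟩, Finset.subset_union_left⟩
    · intro T hT
      exact Finset.union_sdiff_of_subset (mem_tilingsWith.1 hT).2
    · intro T hT
      rw [mem_tilingsOf] at hT
      exact Finset.union_sdiff_cancel_left (hP.disjoint_tiles hk hT.1 hd)
  · rw [Finset.card_eq_zero, Finset.eq_empty_iff_forall_notMem]
    intro T hT
    rw [mem_tilingsWith, mem_tilingsOf] at hT
    obtain ⟨hT, hPT⟩ := hT
    have hy := yzCount_union (k := k) (Finset.disjoint_sdiff (s := P) (t := T))
    have hx := xyCount_union (k := k) (Finset.disjoint_sdiff (s := P) (t := T))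
    rw [Finset.union_sdiff_of_subset hPT] at hx hy
    omega


/-! ### Jagged regions and the patches that can end a tiling -/

/-- The part of the `m × a × k` cuboid whose rows `y ∈ [j, j + k)` have length `a` and whose other
rows have length `b`. -/
def region (k m j a b : ℕ) : Finset Cell :=
  (cuboid k m a).filter fun c => (j ≤ c.2.1 ∧ c.2.1 < j + k) ∨ c.1 < b

theorem mem_region {k m j a b : ℕ} {c : Cell} : c ∈ region k m j a b ↔
    (c.1 < a ∧ c.2.1 < m ∧ c.2.2 < k) ∧ ((j ≤ c.2.1 ∧ c.2.1 < j + k) ∨ c.1 < b) := by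
  simp [region, cuboid, mem_box]

theorem region_self (k m j n : ℕ) : region k m j n n = cuboid k m n := by
  ext c
  simp only [mem_region, cuboid, mem_box]
  omega

/-- The `k × k × 1` brick parallel to the `yz`-plane with corner `(x, y, 0)`. -/
abbrev vBrick (k x y : ℕ) : Finset Cell := box (x, y, 0) 1 k k

/-- The `k × k × 1` brick parallel to the `xz`-plane with corner `(x, y, 0)`. -/
abbrev sBrick (k x y : ℕ) : Finset Cell := box (x, y, 0) k 1 k

/-- The `k × k × 1` brick parallel to the `xy`-plane with corner `(x, y, z)`. -/
abbrev hBrick (k x y z : ℕ) : Finset Cell := box (x, y, z) k k 1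

/-- The rows outside `[j, j + k)`. -/
def outer (k m j : ℕ) : Finset ℕ := (Finset.range m).filter fun y => ¬(j ≤ y ∧ y < j + k)

theorem mem_outer {k m j y : ℕ} : y ∈ outer k m j ↔ y < m ∧ ¬(j ≤ y ∧ y < j + k) := by
  simp [outer]

/-- The bricks parallel to the `xz`-plane that end at `ℓ y` in the rows `y ∈ Y`. -/
def sRows (k : ℕ) (ℓ : ℕ → ℕ) (Y : Finset ℕ) : Finset (Finset Cell) :=
  Y.image fun y => sBrick k (ℓ y - k) y

/-- The `k × k × k` cube with corner `(x, y, 0)`, cut parallel to the `xy`-plane. -/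
def hStack (k x y : ℕ) : Finset (Finset Cell) := (Finset.range k).image fun z => hBrick k x y z

/-- The length of the rows of `region k m j a b`. -/
def rowLen (k j a b y : ℕ) : ℕ := if j ≤ y ∧ y < j + k then a else b

theorem mem_sRows {k : ℕ} {ℓ : ℕ → ℕ} {Y : Finset ℕ} {B : Finset Cell} :
    B ∈ sRows k ℓ Y ↔ ∃ y ∈ Y, sBrick k (ℓ y - k) y = B := by
  simp [sRows]

theorem mem_hStack {k x y : ℕ} {B : Finset Cell} :
    B ∈ hStack k x y ↔ ∃ z < k, hBrick k x y z = B := by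
  simp [hStack]

section Counts

variable {k : ℕ}

theorem not_isBrickYZ_sBrick (hk : 2 ≤ k) (x y : ℕ) : ¬IsBrickYZ k (sBrick k x y) := by
  rintro ⟨⟨p, q, r⟩, h⟩
  have := box_inj (by omega) (by omega) (by omega) (by omega) (by omega) (by omega) h
  omega

theorem not_isBrickXY_sBrick (hk : 2 ≤ k) (x y : ℕ) : ¬IsBrickXY k (sBrick k x y) := by
  rintro ⟨⟨p, q, r⟩, h⟩
  have := box_inj (by omega) (by omega) (by omega) (by omega) (by omega) (by omega) h
  omega

theorem not_isBrickYZ_hBrick (hk : 2 ≤ k) (x y z : ℕ) : ¬IsBrickYZ k (hBrick k x y z) := by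
  rintro ⟨⟨p, q, r⟩, h⟩
  have := box_inj (by omega) (by omega) (by omega) (by omega) (by omega) (by omega) h
  omega

theorem not_isBrickXY_vBrick (hk : 2 ≤ k) (x y : ℕ) : ¬IsBrickXY k (vBrick k x y) := by
  rintro ⟨⟨p, q, r⟩, h⟩
  have := box_inj (by omega) (by omega) (by omega) (by omega) (by omega) (by omega) h
  omega

theorem yzCount_eq_zero {P : Finset (Finset Cell)} (h : ∀ B ∈ P, ¬IsBrickYZ k B) :
    yzCount k P = 0 := by
  classical
  rw [yzCount, Finset.card_eq_zero, Finset.filter_eq_empty_iff]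
  exact fun B hB => h B hB

theorem xyCount_eq_zero {P : Finset (Finset Cell)} (h : ∀ B ∈ P, ¬IsBrickXY k B) :
    xyCount k P = 0 := by
  classical
  rw [xyCount, Finset.card_eq_zero, Finset.filter_eq_empty_iff]
  exact fun B hB => h B hB

theorem yzCount_sRows (hk : 2 ≤ k) (ℓ : ℕ → ℕ) (Y : Finset ℕ) : yzCount k (sRows k ℓ Y) = 0 := by
  refine yzCount_eq_zero fun B hB => ?_
  obtain ⟨y, -, rfl⟩ := mem_sRows.1 hB
  exact not_isBrickYZ_sBrick hk _ _

theorem xyCount_sRows (hk : 2 ≤ k) (ℓ : ℕ → ℕ) (Y : Finset ℕ) : xyCount k (sRows k ℓ Y) = 0 := by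
  refine xyCount_eq_zero fun B hB => ?_
  obtain ⟨y, -, rfl⟩ := mem_sRows.1 hB
  exact not_isBrickXY_sBrick hk _ _

theorem yzCount_singleton_vBrick (x y : ℕ) : yzCount k {vBrick k x y} = 1 := by
  classical
  rw [yzCount, Finset.filter_true_of_mem, Finset.card_singleton]
  simp only [Finset.mem_singleton, forall_eq]
  exact ⟨_, rfl⟩

theorem xyCount_singleton_vBrick (hk : 2 ≤ k) (x y : ℕ) : xyCount k {vBrick k x y} = 0 := by
  refine xyCount_eq_zero fun B hB => ?_
  rw [Finset.mem_singleton.1 hB]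
  exact not_isBrickXY_vBrick hk _ _

theorem yzCount_hStack (hk : 2 ≤ k) (x y : ℕ) : yzCount k (hStack k x y) = 0 := by
  refine yzCount_eq_zero fun B hB => ?_
  obtain ⟨z, -, rfl⟩ := mem_hStack.1 hB
  exact not_isBrickYZ_hBrick hk _ _ _

theorem xyCount_hStack (hk : 2 ≤ k) (x y : ℕ) : xyCount k (hStack k x y) = k := by
  classical
  rw [xyCount, Finset.filter_true_of_mem, hStack, Finset.card_image_of_injective,
    Finset.card_range]
  · intro z z' h
    have := box_inj (by omega) (by omega) (by omega) (by omega) (by omega) (by omega) h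
    omega
  · intro B hB
    obtain ⟨z, -, rfl⟩ := mem_hStack.1 hB
    exact ⟨_, rfl⟩

end Counts

/-! ### Removing an end patch leaves a region of the same family -/

section Patches

variable {k m j a b : ℕ}

/-- With `b < a`, the slice `x = a - 1` of the region is exactly this one brick, so the overhang
shrinks by one. -/
theorem card_tilingsWith_vBrick (hk : 2 ≤ k) (hj : j + k ≤ m) (hab : b < a) (r s : ℕ) :
    (tilingsWith k (region k m j a b) r s {vBrick k (a - 1) j}).card =
      if 1 ≤ r then (tilingsOf k (region k m j (a - 1) b) (r - 1) s).card else 0 := by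
  rw [card_tilingsWith (by omega) (R' := region k m j (a - 1) b), yzCount_singleton_vBrick,
    xyCount_singleton_vBrick hk]
  · simp
  · simp only [Finset.mem_singleton, forall_eq]
    exact Or.inl ⟨_, rfl⟩
  · simp
  · simp only [Finset.mem_singleton, forall_eq]
    intro c
    simp only [mem_box, mem_region]
    omega
  · intro c
    simp only [Finset.mem_singleton, forall_eq, mem_box, mem_region]
    omega

theorem card_tilingsWith_vBrick_sRows (hk : 2 ≤ k) (hj : j + k ≤ m) (hka : k ≤ a) (r s : ℕ) :
    (tilingsWith k (region k m j a a) r s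
      ({vBrick k (a - 1) j} ∪ sRows k (fun _ => a) (outer k m j))).card =
      if 1 ≤ r then (tilingsOf k (region k m j (a - 1) (a - k)) (r - 1) s).card else 0 := by
  have hd : Disjoint {vBrick k (a - 1) j} (sRows k (fun _ => a) (outer k m j)) := by
    rw [Finset.disjoint_singleton_left, mem_sRows]
    rintro ⟨y, -, h⟩
    have := box_inj (by omega) (by omega) (by omega) (by omega) (by omega) (by omega) h
    omega
  have hmem : ∀ B ∈ {vBrick k (a - 1) j} ∪ sRows k (fun _ => a) (outer k m j),
      B = vBrick k (a - 1) j ∨ ∃ y, (y < m ∧ ¬(j ≤ y ∧ y < j + k)) ∧ B = sBrick k (a - k) y := by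
    intro B hB
    rcases Finset.mem_union.1 hB with hB | hB
    · exact Or.inl (Finset.mem_singleton.1 hB)
    · obtain ⟨y, hy, rfl⟩ := mem_sRows.1 hB
      exact Or.inr ⟨y, mem_outer.1 hy, rfl⟩
  rw [card_tilingsWith (by omega) (R' := region k m j (a - 1) (a - k)), yzCount_union hd,
    xyCount_union hd, yzCount_singleton_vBrick, xyCount_singleton_vBrick hk, yzCount_sRows hk,
    xyCount_sRows hk]
  · simp
  · intro B hB
    rcases hmem B hB with rfl | ⟨y, -, rfl⟩
    · exact Or.inl ⟨_, rfl⟩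
    · exact Or.inr (Or.inl ⟨_, rfl⟩)
  · intro B hB C hC hne
    rw [Finset.disjoint_left]
    intro c
    rcases hmem B hB with rfl | ⟨y, hy, rfl⟩ <;> rcases hmem C hC with rfl | ⟨y', hy', rfl⟩
    · exact absurd rfl hne
    · simp only [mem_box]
      omega
    · simp only [mem_box]
      omega
    · have : y ≠ y' := fun h => hne (h ▸ rfl)
      simp only [mem_box]
      omega
  · intro B hB c
    rcases hmem B hB with rfl | ⟨y, hy, rfl⟩ <;> simp only [mem_box, mem_region] <;> omega
  · intro c
    constructor
    · intro hc
      simp only [mem_region] at hc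
      refine ⟨mem_region.2 (by omega), fun B hB => ?_⟩
      rcases hmem B hB with rfl | ⟨y, hy, rfl⟩ <;> simp only [mem_box] <;> omega
    · rintro ⟨hc, hn⟩
      have h₁ := hn _ (Finset.mem_union_left _ (Finset.mem_singleton_self _))
      have h₂ := fun h => hn _ (Finset.mem_union_right _ (mem_sRows.2 ⟨c.2.1, mem_outer.2 h, rfl⟩))
      simp only [mem_region, mem_box] at hc h₁ h₂ ⊢
      omega

theorem card_tilingsWith_sRows (hk : 2 ≤ k) (hba : b ≤ a) (hkb : k ≤ b) (hab : a < b + k) (r s : ℕ) :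
    (tilingsWith k (region k m j a b) r s (sRows k (rowLen k j a b) (Finset.range m))).card =
      (tilingsOf k (region k m j (a - k) (b - k)) r s).card := by
  have hlen : ∀ y, (j ≤ y ∧ y < j + k ∧ rowLen k j a b y = a) ∨
      (¬(j ≤ y ∧ y < j + k) ∧ rowLen k j a b y = b) := by
    intro y
    unfold rowLen
    split_ifs <;> omega
  rw [card_tilingsWith (by omega) (R' := region k m j (a - k) (b - k)), yzCount_sRows hk,
    xyCount_sRows hk]
  · simp
  · intro B hB
    obtain ⟨y, -, rfl⟩ := mem_sRows.1 hB
    exact Or.inr (Or.inl ⟨_, rfl⟩)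
  · intro B hB C hC hne
    obtain ⟨y, -, rfl⟩ := mem_sRows.1 hB
    obtain ⟨y', -, rfl⟩ := mem_sRows.1 hC
    have : y ≠ y' := fun h => hne (h ▸ rfl)
    rw [Finset.disjoint_left]
    intro c
    simp only [mem_box]
    omega
  · intro B hB c
    obtain ⟨y, hy, rfl⟩ := mem_sRows.1 hB
    rw [Finset.mem_range] at hy
    have := hlen y
    simp only [mem_box, mem_region]
    omega
  · intro c
    constructor
    · intro hc
      simp only [mem_region] at hc
      refine ⟨mem_region.2 (by omega), fun B hB => ?_⟩
      obtain ⟨y, hy, rfl⟩ := mem_sRows.1 hB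
      have := hlen y
      simp only [mem_box]
      omega
    · rintro ⟨hc, hn⟩
      rw [mem_region] at hc
      have h := hn _ (mem_sRows.2 ⟨c.2.1, Finset.mem_range.2 hc.1.2.1, rfl⟩)
      have := hlen c.2.1
      simp only [mem_region, mem_box] at h ⊢
      omega

theorem card_tilingsWith_hStack_sRows (hk : 2 ≤ k) (hj : j + k ≤ m) (hba : b ≤ a) (hkb : k ≤ b)
    (hab : a < b + k) (r s : ℕ) :
    (tilingsWith k (region k m j a b) r s
      (hStack k (a - k) j ∪ sRows k (fun _ => b) (outer k m j))).card =
      if k ≤ s then (tilingsOf k (region k m j (a - k) (b - k)) r (s - k)).card else 0 := by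
  have hd : Disjoint (hStack k (a - k) j) (sRows k (fun _ => b) (outer k m j)) := by
    rw [Finset.disjoint_left]
    intro B hB
    rw [mem_sRows]
    rintro ⟨y, -, h⟩
    obtain ⟨z, -, rfl⟩ := mem_hStack.1 hB
    have := box_inj (by omega) (by omega) (by omega) (by omega) (by omega) (by omega) h
    omega
  have hmem : ∀ B ∈ hStack k (a - k) j ∪ sRows k (fun _ => b) (outer k m j),
      (∃ z, z < k ∧ B = hBrick k (a - k) j z) ∨
        ∃ y, (y < m ∧ ¬(j ≤ y ∧ y < j + k)) ∧ B = sBrick k (b - k) y := by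
    intro B hB
    rcases Finset.mem_union.1 hB with hB | hB
    · obtain ⟨z, hz, rfl⟩ := mem_hStack.1 hB
      exact Or.inl ⟨z, hz, rfl⟩
    · obtain ⟨y, hy, rfl⟩ := mem_sRows.1 hB
      exact Or.inr ⟨y, mem_outer.1 hy, rfl⟩
  rw [card_tilingsWith (by omega) (R' := region k m j (a - k) (b - k)), yzCount_union hd,
    xyCount_union hd, yzCount_hStack hk, xyCount_hStack hk, yzCount_sRows hk, xyCount_sRows hk]
  · simp
  · intro B hB
    rcases hmem B hB with ⟨z, -, rfl⟩ | ⟨y, -, rfl⟩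
    · exact Or.inr (Or.inr ⟨_, rfl⟩)
    · exact Or.inr (Or.inl ⟨_, rfl⟩)
  · intro B hB C hC hne
    rw [Finset.disjoint_left]
    intro c
    rcases hmem B hB with ⟨z, hz, rfl⟩ | ⟨y, hy, rfl⟩ <;>
      rcases hmem C hC with ⟨z', hz', rfl⟩ | ⟨y', hy', rfl⟩
    · have : z ≠ z' := fun h => hne (h ▸ rfl)
      simp only [mem_box]
      omega
    · simp only [mem_box]
      omega
    · simp only [mem_box]
      omega
    · have : y ≠ y' := fun h => hne (h ▸ rfl)
      simp only [mem_box]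
      omega
  · intro B hB c
    rcases hmem B hB with ⟨z, hz, rfl⟩ | ⟨y, hy, rfl⟩ <;>
      simp only [mem_box, mem_region] <;> omega
  · intro c
    constructor
    · intro hc
      simp only [mem_region] at hc
      refine ⟨mem_region.2 (by omega), fun B hB => ?_⟩
      rcases hmem B hB with ⟨z, hz, rfl⟩ | ⟨y, hy, rfl⟩ <;> simp only [mem_box] <;> omega
    · rintro ⟨hc, hn⟩
      rw [mem_region] at hc
      have h₁ := hn _ (Finset.mem_union_left _ (mem_hStack.2 ⟨c.2.2, hc.1.2.2, rfl⟩))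
      have h₂ := fun h => hn _ (Finset.mem_union_right _ (mem_sRows.2 ⟨c.2.1, mem_outer.2 h, rfl⟩))
      simp only [mem_region, mem_box] at h₁ h₂ ⊢
      omega

end Patches


/-! ### Classification of the ends of a tiling -/

section Structure

variable {k m j a b : ℕ} {T : Finset (Finset Cell)}

/-- The brick covering the last cell of a row is one of three. -/
theorem exists_brick_of_last (hT : IsTilingOf k (region k m j a b) T) (hk : 2 ≤ k) {x y z : ℕ}
    (hc : (x, y, z) ∈ region k m j a b) (hc' : (x + 1, y, z) ∉ region k m j a b) :
    (∃ i, i ≤ y ∧ y < i + k ∧ i + k ≤ m ∧ vBrick k x i ∈ T) ∨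
      (k ≤ x + 1 ∧ sBrick k (x + 1 - k) y ∈ T) ∨
      ∃ i, i ≤ y ∧ y < i + k ∧ i + k ≤ m ∧ k ≤ x + 1 ∧ hBrick k (x + 1 - k) i z ∈ T := by
  obtain ⟨B, hB, hcB⟩ := hT.exists_mem hc
  have hsub := hT.subset hB
  rcases hT.isBrick B hB with ⟨⟨p, q, r⟩, rfl⟩ | ⟨⟨p, q, r⟩, rfl⟩ | ⟨⟨p, q, r⟩, rfl⟩
  -- The far corner of the brick lies in the region, whose height is `k`; a brick of height `k` thus
  -- starts at height 0.
  · have h := @hsub (p, q + k - 1, r + k - 1)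
    simp only [mem_box, mem_region] at hcB h
    obtain ⟨rfl, rfl⟩ : r = 0 ∧ p = x := by omega
    exact Or.inl ⟨q, by omega, by omega, by omega, hB⟩
  · have h := @hsub (p, q, r + k - 1)
    have h' := @hsub (p + k - 1, q, z)
    simp only [mem_box, mem_region] at hcB h h' hc hc'
    obtain ⟨rfl, rfl, rfl⟩ : r = 0 ∧ q = y ∧ p = x + 1 - k := by omega
    exact Or.inr (Or.inl ⟨by omega, hB⟩)
  · have h := @hsub (p, q + k - 1, r)
    have h' := @hsub (p + k - 1, y, z)
    simp only [mem_box, mem_region] at hcB h h' hc hc'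
    obtain ⟨rfl, rfl⟩ : r = z ∧ p = x + 1 - k := by omega
    exact Or.inr (Or.inr ⟨q, by omega, by omega, by omega, by omega, hB⟩)

/-- Bricks not parallel to the `xz`-plane meet the row `k - 1`, so a row avoided by the brick
that meets the row `k - 1` opposite to its end must end with a brick parallel to the
`xz`-plane. -/
theorem sBrick_mem (hT : IsTilingOf k (region k m j a b) T) (hk : 2 ≤ k) (hmk : m < 2 * k)
    {x y : ℕ} (hc : (x, y, 0) ∈ region k m j a b) (hc' : (x + 1, y, 0) ∉ region k m j a b)
    {B : Finset Cell} (hB : B ∈ T) (h₁ : (x, k - 1, 0) ∈ B) (h₂ : (x, y, 0) ∉ B) :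
    k ≤ x + 1 ∧ sBrick k (x + 1 - k) y ∈ T := by
  rcases exists_brick_of_last hT hk hc hc' with ⟨i, h, h', h'', hV⟩ | hS | ⟨i, h, h', h'', _, hH⟩
  · have := hT.eq_of_mem hB hV h₁ (by simp only [mem_box]; omega)
    exact absurd (this ▸ by simp only [mem_box]; omega) h₂
  · exact hS
  · have := hT.eq_of_mem hB hH h₁ (by simp only [mem_box]; omega)
    exact absurd (this ▸ by simp only [mem_box]; omega) h₂

/-- The possible ends of a tiling of `region k m j a b`. -/
theorem tiling_end (hT : IsTilingOf k (region k m j a b) T) (hk : 2 ≤ k) (hkm : k < m)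
    (hmk : m < 2 * k) (hj : j + k ≤ m) (ha : 0 < a) (hba : b ≤ a) (hab : a < b + k) :
    (∃ i, i + k ≤ m ∧ (b < a → i = j) ∧ vBrick k (a - 1) i ∈ T ∧
      (a = b → k ≤ b ∧ sRows k (fun _ => a) (outer k m i) ⊆ T)) ∨
    (k ≤ b ∧ sRows k (rowLen k j a b) (Finset.range m) ⊆ T) ∨
    ∃ i, i + k ≤ m ∧ (b < a → i = j) ∧ k ≤ b ∧
      hStack k (a - k) i ∪ sRows k (fun _ => b) (outer k m i) ⊆ T := by
  -- `w` is a row outside `[j, j + k)`, which exists because `k < m`. Its length is `b`, so a brick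
  -- parallel to the `xz`-plane ending it shows `k ≤ b`.
  obtain ⟨w, hw, hwm⟩ : ∃ w, w < m ∧ (j = 0 → w = m - 1) ∧ (0 < j → w = 0) := by
    rcases Nat.eq_zero_or_pos j with h | h
    · exact ⟨m - 1, by omega, by omega, by omega⟩
    · exact ⟨0, by omega, by omega, by omega⟩
  have key : ∀ x y B, (x, y, 0) ∈ region k m j a b → (x + 1, y, 0) ∉ region k m j a b → B ∈ T →
      (x, k - 1, 0) ∈ B → (x, y, 0) ∉ B → k ≤ x + 1 ∧ sBrick k (x + 1 - k) y ∈ T :=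
    fun x y B h h' hB h₁ h₂ => sBrick_mem hT hk hmk h h' hB h₁ h₂
  have hlast : ∀ z < k, (a - 1, k - 1, z) ∈ region k m j a b ∧
      (a - 1 + 1, k - 1, z) ∉ region k m j a b := by
    intro z hz
    simp only [mem_region]
    omega
  rcases exists_brick_of_last hT hk (hlast 0 (by omega)).1 (hlast 0 (by omega)).2 with
    ⟨i, h, h', him, hV⟩ | ⟨hka, hS⟩ | ⟨i, h, h', him, hka, hH⟩
  · refine Or.inl ⟨i, him, ?_, hV, ?_⟩
    · intro hlt
      have h₁ := hT.subset hV (show (a - 1, i, 0) ∈ _ by simp only [mem_box]; omega)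
      have h₂ := hT.subset hV (show (a - 1, i + k - 1, 0) ∈ _ by simp only [mem_box]; omega)
      simp only [mem_region] at h₁ h₂
      omega
    · rintro rfl
      have hout : ∀ y, y < m → ¬(i ≤ y ∧ y < i + k) → k ≤ a ∧ sBrick k (a - k) y ∈ T := by
        intro y hy hyo
        have := key (a - 1) y _ (by simp only [mem_region]; omega)
          (by simp only [mem_region]; omega) hV (by simp only [mem_box]; omega)
          (by simp only [mem_box]; omega)
        rwa [show a - 1 + 1 = a by omega] at this
      constructor
      · rcases Nat.eq_zero_or_pos i with hi | hi
        · exact (hout (m - 1) (by omega) (by omega)).1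
        · exact (hout 0 (by omega) (by omega)).1
      · intro B hB
        obtain ⟨y, hy, rfl⟩ := mem_sRows.1 hB
        rw [mem_outer] at hy
        exact (hout y hy.1 hy.2).2
  · rw [show a - 1 + 1 = a by omega] at hka hS
    have hall : ∀ y, y < m → k ≤ rowLen k j a b y ∧ sBrick k (rowLen k j a b y - k) y ∈ T := by
      intro y hy
      have hlen : (j ≤ y ∧ y < j + k ∧ rowLen k j a b y = a) ∨
          (¬(j ≤ y ∧ y < j + k) ∧ rowLen k j a b y = b) := by
        unfold rowLen
        split_ifs <;> omega
      by_cases hyk : y = k - 1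
      · subst hyk
        rw [show rowLen k j a b (k - 1) = a by omega]
        exact ⟨hka, hS⟩
      · have := key (rowLen k j a b y - 1) y _ (by simp only [mem_region]; omega)
          (by simp only [mem_region]; omega) hS (by simp only [mem_box]; omega)
          (by simp only [mem_box]; omega)
        rwa [show rowLen k j a b y - 1 + 1 = rowLen k j a b y by omega] at this
    refine Or.inr (Or.inl ⟨?_, ?_⟩)
    · have := (hall w hw).1
      unfold rowLen at this
      split_ifs at this <;> omega
    · intro B hB
      obtain ⟨y, hy, rfl⟩ := mem_sRows.1 hB
      exact (hall y (Finset.mem_range.1 hy)).2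
  · rw [show a - 1 + 1 = a by omega] at hka hH
    have hij : b < a → i = j := by
      intro hlt
      have h₁ := hT.subset hH (show (a - 1, i, 0) ∈ _ by simp only [mem_box]; omega)
      have h₂ := hT.subset hH (show (a - 1, i + k - 1, 0) ∈ _ by simp only [mem_box]; omega)
      simp only [mem_region] at h₁ h₂
      omega
    have hout : ∀ y, y < m → ¬(i ≤ y ∧ y < i + k) → k ≤ b ∧ sBrick k (b - k) y ∈ T := by
      intro y hy hyo
      -- The brick occupies `x` from `a - k` to `a - 1`, a range that contains `b - 1` because `a <
      -- b + k`.
      have := key (b - 1) y _ (by simp only [mem_region]; omega)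
        (by simp only [mem_region]; omega) hH (by simp only [mem_box]; omega)
        (by simp only [mem_box]; omega)
      rwa [show b - 1 + 1 = b by omega] at this
    -- A brick of full height covering `(a - 1, y, z)` would meet the brick `hH` at height 0, so
    -- only bricks parallel to the `xy`-plane are possible.
    have hrow : ∀ y z, i ≤ y → y < i + k → z < k →
        ∃ l, l ≤ y ∧ y < l + k ∧ l + k ≤ m ∧ hBrick k (a - k) l z ∈ T := by
      intro y z hy hy' hz
      rcases exists_brick_of_last hT hk (x := a - 1) (y := y) (z := z)
        (by simp only [mem_region]; omega) (by simp only [mem_region]; omega) with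
        ⟨l, h₁, h₂, h₃, hV⟩ | ⟨-, hS⟩ | ⟨l, h₁, h₂, h₃, -, hH'⟩
      · have := hT.eq_of_mem hV hH (c := (a - 1, k - 1, 0)) (by simp only [mem_box]; omega)
          (by simp only [mem_box]; omega)
        have := box_inj (by omega) (by omega) (by omega) (by omega) (by omega) (by omega) this
        omega
      · have := hT.eq_of_mem hS hH (c := (a - 1, y, 0)) (by simp only [mem_box]; omega)
          (by simp only [mem_box]; omega)
        have := box_inj (by omega) (by omega) (by omega) (by omega) (by omega) (by omega) this
        omega
      · rw [show a - 1 + 1 = a by omega] at hH'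
        exact ⟨l, h₁, h₂, h₃, hH'⟩
    refine Or.inr (Or.inr ⟨i, him, hij, ?_, ?_⟩)
    · rcases Nat.eq_zero_or_pos i with hi | hi
      · exact (hout (m - 1) (by omega) (by omega)).1
      · exact (hout 0 (by omega) (by omega)).1
    · intro B hB
      rcases Finset.mem_union.1 hB with hB | hB
      · obtain ⟨z, hz, rfl⟩ := mem_hStack.1 hB
        obtain ⟨l, h₁, h₂, h₃, hl⟩ := hrow i z (by omega) (by omega) hz
        obtain ⟨l', h₁', h₂', h₃', hl'⟩ := hrow (i + k - 1) z (by omega) (by omega) hz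
        -- In layer `z`, the bricks over the rows `i` and `i + k - 1` both cross the row `k - 1`, so
        -- they coincide. A brick of width `k` containing both rows starts at `i`.
        have := hT.eq_of_mem hl hl' (c := (a - 1, k - 1, z)) (by simp only [mem_box]; omega)
          (by simp only [mem_box]; omega)
        have := box_inj (by omega) (by omega) (by omega) (by omega) (by omega) (by omega) this
        obtain rfl : l = i := by omega
        exact hl
      · obtain ⟨y, hy, rfl⟩ := mem_sRows.1 hB
        rw [mem_outer] at hy
        exact (hout y hy.1 hy.2).2

end Structure

/-! ### Recurrences for the numbers of tilings -/

section Recursion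

variable {k m : ℕ}

/-- The number of tilings of `region k m j a b` with `r` bricks parallel to the `yz`-plane and `s`
bricks parallel to the `xy`-plane. -/
noncomputable def count (k m j a b r s : ℕ) : ℕ := (tilingsOf k (region k m j a b) r s).card

theorem count_self (k m j n r s : ℕ) : count k m j n n r s = d k m n r s := by
  rw [count, region_self, d_eq_card]

theorem d_zero (k m r s : ℕ) (hk : 2 ≤ k) : d k m 0 r s = if r = 0 ∧ s = 0 then 1 else 0 := by
  have hT : ∀ T, IsTilingOf k (cuboid k m 0) T ↔ T = ∅ := by
    intro T
    constructor
    · intro h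
      rw [Finset.eq_empty_iff_forall_notMem]
      intro B hB
      obtain ⟨c, hc⟩ := (h.isBrick B hB).nonempty (by omega)
      have := h.subset hB hc
      simp [cuboid, mem_box] at this
    · rintro rfl
      exact ⟨by simp, by simp, by ext c; simp [cuboid, mem_box]⟩
  have hy : yzCount k ∅ = 0 := yzCount_eq_zero (by simp)
  have hx : xyCount k ∅ = 0 := xyCount_eq_zero (by simp)
  rw [d_eq_card]
  split_ifs with h
  · rw [Finset.card_eq_one]
    refine ⟨∅, ?_⟩
    ext T
    rw [mem_tilingsOf, hT, Finset.mem_singleton]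
    constructor
    · exact fun h => h.1
    · rintro rfl
      exact ⟨rfl, by omega, by omega⟩
  · rw [Finset.card_eq_zero, Finset.eq_empty_iff_forall_notMem]
    intro T
    rw [mem_tilingsOf, hT]
    rintro ⟨rfl, h₁, h₂⟩
    omega

/-- The short rows have no room for a brick of length `k`, so only the end with a brick parallel to
the `yz`-plane survives. -/
theorem count_of_lt_of_lt (hk : 2 ≤ k) (hkm : k < m) (hmk : m < 2 * k) {j a b : ℕ}
    (hj : j + k ≤ m) (hba : b < a) (hab : a < b + k) (hbk : b < k) (r s : ℕ) :
    count k m j a b r s = if 1 ≤ r then count k m j (a - 1) b (r - 1) s else 0 := by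
  classical
  rw [count, card_tilingsOf_eq_sum (Finset.univ : Finset Unit) (fun _ => {vBrick k (a - 1) j})]
  · rw [Finset.univ_unique, Finset.sum_singleton, card_tilingsWith_vBrick hk hj hba]
    rfl
  · intro T hT
    rcases tiling_end hT hk hkm hmk hj (by omega) hba.le hab with
      ⟨i, -, hi, hV, -⟩ | ⟨h, -⟩ | ⟨i, -, -, h, -⟩
    · obtain rfl := hi hba
      exact ⟨(), Finset.mem_univ _, Finset.singleton_subset_iff.2 hV⟩
    · omega
    · omega
  · intros
    rfl

/-- Every possible end of a flat region has a row ending with a brick parallel to the `xz`-plane,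
which needs length `k`. -/
theorem d_of_lt (hk : 2 ≤ k) (hkm : k < m) (hmk : m < 2 * k) {n : ℕ} (hn : 0 < n) (hnk : n < k)
    (r s : ℕ) : d k m n r s = 0 := by
  rw [← count_self k m 0, count, Finset.card_eq_zero, Finset.eq_empty_iff_forall_notMem]
  intro T hT
  rcases tiling_end (mem_tilingsOf.1 hT).1 hk hkm hmk (by omega) hn le_rfl (by omega) with
    ⟨i, -, -, -, h⟩ | ⟨h, -⟩ | ⟨i, -, -, h, -⟩
  · have := (h rfl).1
    omega
  · omega
  · omega

/-- This is the brick of the patch that covers the last cell of the row `k - 1`; it serves to tell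
the patches apart. -/
theorem sBrick_mem_sRows (hkm : k < m) (hk : 2 ≤ k) (hmk : m < 2 * k) {j a b : ℕ}
    (hj : j + k ≤ m) : sBrick k (a - k) (k - 1) ∈ sRows k (rowLen k j a b) (Finset.range m) :=
  mem_sRows.2 ⟨k - 1, Finset.mem_range.2 (by omega), by rw [rowLen, if_pos (by omega)]⟩

theorem hBrick_mem_hStack (hk : 2 ≤ k) (x y : ℕ) (P : Finset (Finset Cell)) :
    hBrick k x y 0 ∈ hStack k x y ∪ P :=
  Finset.mem_union_left _ (mem_hStack.2 ⟨0, by omega, rfl⟩)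

/-- The three summands are the three kinds of end. The jagged boundary fixes the crosswise position
at `j`, so each kind has a single patch. -/
theorem count_of_lt_of_le (hk : 2 ≤ k) (hkm : k < m) (hmk : m < 2 * k) {j a b : ℕ}
    (hj : j + k ≤ m) (hba : b < a) (hab : a < b + k) (hkb : k ≤ b) (r s : ℕ) :
    count k m j a b r s = (if 1 ≤ r then count k m j (a - 1) b (r - 1) s else 0) +
      (count k m j (a - k) (b - k) r s +
        if k ≤ s then count k m j (a - k) (b - k) r (s - k) else 0) := by
  classical
  let P : Unit ⊕ Unit ⊕ Unit → Finset (Finset Cell) :=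
    Sum.elim (fun _ => {vBrick k (a - 1) j}) (Sum.elim
      (fun _ => sRows k (rowLen k j a b) (Finset.range m))
      fun _ => hStack k (a - k) j ∪ sRows k (fun _ => b) (outer k m j))
  rw [count, card_tilingsOf_eq_sum Finset.univ P]
  · simp only [Fintype.sum_sum_type, P, Sum.elim_inl, Sum.elim_inr, Finset.univ_unique,
      Finset.sum_singleton, card_tilingsWith_vBrick hk hj hba, card_tilingsWith_sRows hk hba.le hkb hab,
      card_tilingsWith_hStack_sRows hk hj hba.le hkb hab]
    rfl
  · intro T hT
    rcases tiling_end hT hk hkm hmk hj (by omega) hba.le hab with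
      ⟨i, -, hi, hV, -⟩ | ⟨-, h⟩ | ⟨i, -, hi, -, h⟩
    · obtain rfl := hi hba
      exact ⟨Sum.inl (), Finset.mem_univ _, Finset.singleton_subset_iff.2 hV⟩
    · exact ⟨Sum.inr (Sum.inl ()), Finset.mem_univ _, h⟩
    · obtain rfl := hi hba
      exact ⟨Sum.inr (Sum.inr ()), Finset.mem_univ _, h⟩
  · intro T hT p _ q _ hp hq
    -- `C p` is the brick of `P p` through the cell `(a - 1, k - 1, 0)`. A tiling has only one brick
    -- there, so it contains only one of the patches.
    let C : Unit ⊕ Unit ⊕ Unit → Finset Cell :=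
      Sum.elim (fun _ => vBrick k (a - 1) j) (Sum.elim
        (fun _ => sBrick k (a - k) (k - 1)) fun _ => hBrick k (a - k) j 0)
    have hC : ∀ p, C p ∈ P p := by
      rintro (_ | _ | _)
      · exact Finset.mem_singleton_self _
      · exact sBrick_mem_sRows hkm hk hmk hj
      · exact hBrick_mem_hStack hk _ _ _
    have hmem : ∀ p, (a - 1, k - 1, 0) ∈ C p := by
      rintro (_ | _ | _) <;> simp only [C, Sum.elim_inl, Sum.elim_inr, mem_box] <;> omega
    have h := hT.eq_of_mem (hp (hC p)) (hq (hC q)) (hmem p) (hmem q)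
    rcases p with _ | _ | _ <;> rcases q with _ | _ | _ <;> first
      | rfl
      | exfalso
        dsimp only [C, Sum.elim_inl, Sum.elim_inr] at h
        have := box_inj (by omega) (by omega) (by omega) (by omega) (by omega) (by omega) h
        omega

/-- At a flat end a crosswise brick or stack may start at any of the `m - k + 1` rows `j` with `j +
k ≤ m`; the end made only of bricks parallel to the `xz`-plane is unique. -/
theorem d_of_le (hk : 2 ≤ k) (hkm : k < m) (hmk : m < 2 * k) {n : ℕ} (hkn : k ≤ n) (r s : ℕ) :
    d k m n r s = (∑ j ∈ Finset.range (m - k + 1),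
        if 1 ≤ r then count k m j (n - 1) (n - k) (r - 1) s else 0) +
      (d k m (n - k) r s + (m - k + 1) * if k ≤ s then d k m (n - k) r (s - k) else 0) := by
  classical
  let I := Fin (m - k + 1)
  have hI : ∀ j : I, (j : ℕ) + k ≤ m := fun j => by have := j.2; omega
  let P : I ⊕ Unit ⊕ I → Finset (Finset Cell) :=
    Sum.elim (fun j => {vBrick k (n - 1) j} ∪ sRows k (fun _ => n) (outer k m j)) (Sum.elim
      (fun _ => sRows k (rowLen k 0 n n) (Finset.range m))
      fun j => hStack k (n - k) j ∪ sRows k (fun _ => n) (outer k m j))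
  have hV : ∀ j : I, (tilingsWith k (cuboid k m n) r s
      ({vBrick k (n - 1) j} ∪ sRows k (fun _ => n) (outer k m j))).card =
      if 1 ≤ r then count k m j (n - 1) (n - k) (r - 1) s else 0 := by
    intro j
    rw [← region_self k m j, card_tilingsWith_vBrick_sRows hk (hI j) hkn]
    rfl
  have hS : (tilingsWith k (cuboid k m n) r s
      (sRows k (rowLen k 0 n n) (Finset.range m))).card = d k m (n - k) r s := by
    rw [← region_self k m 0, card_tilingsWith_sRows hk le_rfl hkn (by omega)]
    exact count_self k m 0 _ _ _
  have hH : ∀ j : I, (tilingsWith k (cuboid k m n) r s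
      (hStack k (n - k) j ∪ sRows k (fun _ => n) (outer k m j))).card =
      if k ≤ s then d k m (n - k) r (s - k) else 0 := by
    intro j
    rw [← region_self k m j, card_tilingsWith_hStack_sRows hk (hI j) le_rfl hkn (by omega),
      ← count_self k m j]
    rfl
  rw [d_eq_card, card_tilingsOf_eq_sum Finset.univ P]
  · simp only [Fintype.sum_sum_type, P, Sum.elim_inl, Sum.elim_inr, Finset.univ_unique,
      Finset.card_singleton, one_mul, hV, hS, hH, Finset.sum_const, Finset.card_univ, smul_eq_mul,
      Finset.sum_range, I, Fintype.card_fin]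
  · intro T hT
    rw [← region_self k m 0] at hT
    rcases tiling_end hT hk hkm hmk (by omega) (by omega) le_rfl (by omega) with
      ⟨i, hi, -, hV, h⟩ | ⟨-, h⟩ | ⟨i, hi, -, -, h⟩
    · exact ⟨Sum.inl ⟨i, by omega⟩, Finset.mem_univ _,
        Finset.union_subset (Finset.singleton_subset_iff.2 hV) (h rfl).2⟩
    · exact ⟨Sum.inr (Sum.inl ()), Finset.mem_univ _, h⟩
    · exact ⟨Sum.inr (Sum.inr ⟨i, by omega⟩), Finset.mem_univ _, h⟩
  · intro T hT p _ q _ hp hq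
    rw [← region_self k m 0] at hT
    let C : I ⊕ Unit ⊕ I → Finset Cell :=
      Sum.elim (fun j => vBrick k (n - 1) j) (Sum.elim
        (fun _ => sBrick k (n - k) (k - 1)) fun j => hBrick k (n - k) j 0)
    have hC : ∀ p, C p ∈ P p := by
      rintro (_ | _ | _)
      · exact Finset.mem_union_left _ (Finset.mem_singleton_self _)
      · exact sBrick_mem_sRows hkm hk hmk (by omega)
      · exact hBrick_mem_hStack hk _ _ _
    have hmem : ∀ p, (n - 1, k - 1, 0) ∈ C p := by
      rintro (j | _ | j)
      · have := hI j
        simp only [C, Sum.elim_inl, mem_box]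
        omega
      · simp only [C, Sum.elim_inl, Sum.elim_inr, mem_box]
        omega
      · have := hI j
        simp only [C, Sum.elim_inr, mem_box]
        omega
    have h := hT.eq_of_mem (hp (hC p)) (hq (hC q)) (hmem p) (hmem q)
    rcases p with i | _ | i <;> rcases q with l | _ | l <;> first
      | rfl
      | dsimp only [C, Sum.elim_inl, Sum.elim_inr] at h
        have := box_inj (by omega) (by omega) (by omega) (by omega) (by omega) (by omega) h
        first
        | omega
        | obtain rfl : i = l := Fin.ext (by omega)
          rfl

end Recursion


/-! ### Translation into power series -/

section Series

/-- The power series `∑ h n r s * x ^ n * y ^ r * z ^ s`. -/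
def series (h : ℕ → ℕ → ℕ → ℕ) : MvPowerSeries (Fin 3) ℚ := fun e => (h (e 0) (e 1) (e 2) : ℚ)

theorem coeff_series (h : ℕ → ℕ → ℕ → ℕ) (e : Fin 3 →₀ ℕ) :
    MvPowerSeries.coeff e (series h) = h (e 0) (e 1) (e 2) := rfl

theorem coeff_X_pow_mul_series (a b c : ℕ) (h : ℕ → ℕ → ℕ → ℕ) (e : Fin 3 →₀ ℕ) :
    MvPowerSeries.coeff e
      ((MvPowerSeries.X 0 ^ a * MvPowerSeries.X 1 ^ b * MvPowerSeries.X 2 ^ c) * series h) =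
      ((if a ≤ e 0 ∧ b ≤ e 1 ∧ c ≤ e 2 then h (e 0 - a) (e 1 - b) (e 2 - c) else 0 : ℕ) : ℚ) := by
  have hle : Finsupp.single 0 a + Finsupp.single 1 b + Finsupp.single 2 c ≤ e ↔
      a ≤ e 0 ∧ b ≤ e 1 ∧ c ≤ e 2 := by
    rw [Finsupp.le_def]
    simp [Fin.forall_fin_succ]
  rw [MvPowerSeries.X_pow_eq, MvPowerSeries.X_pow_eq, MvPowerSeries.X_pow_eq,
    MvPowerSeries.monomial_mul_monomial, MvPowerSeries.monomial_mul_monomial,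
    MvPowerSeries.coeff_monomial_mul]
  simp only [hle]
  split_ifs
  · simp [coeff_series]
  · simp

end Series

/-- The generating function of the tilings of the regions `region k m j n (n - δ)`. -/
noncomputable def regionSeries (k m j δ : ℕ) : MvPowerSeries (Fin 3) ℚ :=
  series fun n r s => if δ ≤ n then count k m j n (n - δ) r s else 0

theorem regionSeries_zero (k m j : ℕ) : regionSeries k m j 0 = genFun k m := by
  simp only [regionSeries, zero_le, if_true, Nat.sub_zero, count_self]
  rfl

section Equations

local notation "X₀" => (MvPowerSeries.X 0 : MvPowerSeries (Fin 3) ℚ)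
local notation "X₁" => (MvPowerSeries.X 1 : MvPowerSeries (Fin 3) ℚ)
local notation "X₂" => (MvPowerSeries.X 2 : MvPowerSeries (Fin 3) ℚ)

variable {k m : ℕ}

/-- Removing a brick parallel to the `yz`-plane lowers the overhang by one; the other two ends
shorten all rows by `k` and keep it. The vanishing of `regionSeries` coefficients for `n < δ`
absorbs the case of short rows below `k`. -/
theorem regionSeries_eq (hk : 2 ≤ k) (hkm : k < m) (hmk : m < 2 * k) {j δ : ℕ} (hj : j + k ≤ m)
    (hδ : δ + 1 < k) : regionSeries k m j (δ + 1) =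
      X₀ ^ 1 * X₁ ^ 1 * X₂ ^ 0 * regionSeries k m j δ +
        (X₀ ^ k * X₁ ^ 0 * X₂ ^ 0 * regionSeries k m j (δ + 1) +
          X₀ ^ k * X₁ ^ 0 * X₂ ^ k * regionSeries k m j (δ + 1)) := by
  ext e
  simp only [regionSeries, map_add, coeff_X_pow_mul_series, coeff_series]
  norm_cast
  generalize e 0 = n, e 1 = r, e 2 = s
  by_cases hn : δ + 1 ≤ n
  · by_cases hb : k ≤ n - (δ + 1)
    · rw [if_pos hn, count_of_lt_of_le hk hkm hmk hj (by omega) (by omega) hb]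
      simp only [show n - 1 - δ = n - (δ + 1) by omega, show n - k - (δ + 1) = n - (δ + 1) - k by
        omega, show δ ≤ n - 1 by omega, show 1 ≤ n by omega, show k ≤ n by omega,
        show δ + 1 ≤ n - k by omega, zero_le, true_and, and_true, if_true, Nat.sub_zero]
    · rw [if_pos hn, count_of_lt_of_lt hk hkm hmk hj (by omega) (by omega) (by omega)]
      simp only [show n - 1 - δ = n - (δ + 1) by omega, show δ ≤ n - 1 by omega,
        show 1 ≤ n by omega, show ¬ δ + 1 ≤ n - k by omega, zero_le, true_and, and_true, if_true,
        Nat.sub_zero, if_false, ite_self, add_zero]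
  · simp only [hn, show ¬ δ + 1 ≤ n - k by omega, if_false,
      ite_self, add_zero]
    -- For `n = δ = 0` the truncated condition `δ ≤ n - 1` holds; the factor `x` still excludes this
    -- term through `1 ≤ n`.
    split_ifs <;> omega

theorem genFun_eq (hk : 2 ≤ k) (hkm : k < m) (hmk : m < 2 * k) : genFun k m =
    1 + ((∑ j ∈ Finset.range (m - k + 1), X₀ ^ 1 * X₁ ^ 1 * X₂ ^ 0 * regionSeries k m j (k - 1)) +
      (X₀ ^ k * X₁ ^ 0 * X₂ ^ 0 * genFun k m +
        ((m - k + 1 : ℕ) : MvPowerSeries (Fin 3) ℚ) * (X₀ ^ k * X₁ ^ 0 * X₂ ^ k * genFun k m))) := by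
  have hd : genFun k m = series (d k m) := rfl
  ext e
  rw [hd, ← nsmul_eq_mul]
  simp only [regionSeries, map_add, map_sum, map_nsmul, coeff_X_pow_mul_series, coeff_series,
    MvPowerSeries.coeff_one]
  have he : e = 0 ↔ e 0 = 0 ∧ e 1 = 0 ∧ e 2 = 0 := by
    rw [Finsupp.ext_iff]
    simp [Fin.forall_fin_succ]
  simp only [he, nsmul_eq_mul]
  generalize e 0 = n, e 1 = r, e 2 = s
  norm_cast
  rcases Nat.eq_zero_or_pos n with rfl | hn
  · simp [d_zero _ _ _ _ hk, show ¬ k ≤ 0 by omega]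
  · by_cases hnk : k ≤ n
    · rw [d_of_le hk hkm hmk hnk]
      simp only [show n ≠ 0 by omega, hnk, show k - 1 ≤ n - 1 by omega, show 1 ≤ n by omega,
        show n - 1 - (k - 1) = n - k by omega, zero_le, true_and, and_true, if_true, false_and,
        if_false, zero_add, Nat.sub_zero]
    · rw [d_of_lt hk hkm hmk hn (by omega)]
      simp [show n ≠ 0 by omega, hnk, show ¬ k - 1 ≤ n - 1 by omega]

theorem pow_mul_regionSeries (hk : 2 ≤ k) (hkm : k < m) (hmk : m < 2 * k) {j δ : ℕ}
    (hj : j + k ≤ m) (hδ : δ < k) : (1 - X₀ ^ k - X₀ ^ k * X₂ ^ k) ^ δ * regionSeries k m j δ =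
      (X₀ * X₁) ^ δ * genFun k m := by
  induction δ with
  | zero => simp [regionSeries_zero]
  | succ δ ih =>
    have h : (1 - X₀ ^ k - X₀ ^ k * X₂ ^ k) * regionSeries k m j (δ + 1) =
        X₀ * X₁ * regionSeries k m j δ := by
      linear_combination regionSeries_eq hk hkm hmk hj hδ
    rw [pow_succ, pow_succ]
    linear_combination (1 - X₀ ^ k - X₀ ^ k * X₂ ^ k) ^ δ * h + X₀ * X₁ * ih (by omega)

end Equations

end BrickTiling

/-! ### Solving the linear system -/

theorem mainTheorem4 (k m : ℕ) (hkm : k < m) (hmk : m < 2 * k) :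
    let x : MvPowerSeries (Fin 3) ℚ := MvPowerSeries.X 0
    let y : MvPowerSeries (Fin 3) ℚ := MvPowerSeries.X 1
    let z : MvPowerSeries (Fin 3) ℚ := MvPowerSeries.X 2
    let N : MvPowerSeries (Fin 3) ℚ := (1 - x ^ k - x ^ k * z ^ k) ^ (k - 1)
    let D : MvPowerSeries (Fin 3) ℚ :=
      (1 - x ^ k - ((m : MvPowerSeries (Fin 3) ℚ) - k + 1) * x ^ k * z ^ k) *
          (1 - x ^ k - x ^ k * z ^ k) ^ (k - 1) -
        ((m : MvPowerSeries (Fin 3) ℚ) - k + 1) * x ^ k * y ^ k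
    IsUnit D ∧ BrickTiling.genFun k m = N * D⁻¹ := by
  intro x y z N D
  have hk : 2 ≤ k := by omega
  have hD : MvPowerSeries.constantCoeff D = 1 := by
    simp [D, x, y, z, show k ≠ 0 by omega]
  refine ⟨MvPowerSeries.isUnit_iff_constantCoeff.2 (hD ▸ isUnit_one), ?_⟩
  rw [MvPowerSeries.eq_mul_inv_iff_mul_eq (by rw [hD]; exact one_ne_zero)]
  have hF := BrickTiling.genFun_eq hk hkm hmk
  -- Multiplication by `N` turns each jagged series into a multiple of the generating function that
  -- does not depend on `j`.
  have hsum : N * ∑ j ∈ Finset.range (m - k + 1),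
      x ^ 1 * y ^ 1 * z ^ 0 * BrickTiling.regionSeries k m j (k - 1) =
      ((m - k + 1 : ℕ) : MvPowerSeries (Fin 3) ℚ) *
        (x ^ k * y ^ k * BrickTiling.genFun k m) := by
    rw [Finset.mul_sum, Finset.sum_congr rfl (g := fun _ => x ^ k * y ^ k *
      BrickTiling.genFun k m), Finset.sum_const, Finset.card_range, nsmul_eq_mul]
    intro j hj
    rw [Finset.mem_range] at hj
    have h := BrickTiling.pow_mul_regionSeries hk hkm hmk (j := j) (δ := k - 1) (by omega)
      (by omega)
    have hpow : x ^ k * y ^ k = x * y * (x * y) ^ (k - 1) := by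
      rw [← mul_pow, ← pow_succ', Nat.sub_add_cancel (by omega)]
    rw [hpow]
    linear_combination x * y * h
  have hcast : ((m - k + 1 : ℕ) : MvPowerSeries (Fin 3) ℚ) = m - k + 1 := by
    push_cast [Nat.cast_sub hkm.le]
    ring
  rw [hcast] at hF hsum
  linear_combination N * hF + hsum
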